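/- Let $\Omega=\{0,1\}^{\mathbb N}$, let $x\Omega$ be the set of sequences beginning with the binary word $x$, and let $\mathcal M(\Omega)$ be the set of Borel probability measures on $\Omega$ with the weak topology. A basic set in $\mathcal M(\Omega)$ is given by finitely many conditions $u<P(y\Omega)<v$ ($y$ a binary word, $u,v\in\mathbb Q$). A compact set $\mathcal C\subseteq\mathcal M(\Omega)$ is effectively compact if the set of all finite families of basic sets that cover $\mathcal C$ is recursively enumerable. A function $f:\Omega\to[0,\infty]$ (respectively $f:\Omega\times\mathcal M(\Omega)\to[0,\infty]$) is lower semicomputable if for every rational $r$ the set $\{r<f\}$ is the union of a family of intervals $x\Omega$ (respectively of products $x\Omega\times\beta$, $\beta$ basic) that is recursively enumerable uniformly in $r$. A $\mathcal C$-test is a lower semicomputable $t:\Omega\to[0,\infty]$ with $\int t\,dP\le 1$ for all $P\in\mathcal C$. A uniform test is a lower semicomputable $t:\Omega\times\mathcal M(\Omega)\to[0,\infty]$ with $\int t(\omega,P)\,dP(\omega)\le1$ for all $P\in\mathcal M(\Omega)$. In each of these two classes of tests, a test $t$ is universal if for every test $s$ of the same class there is a finite constant $c$ with $s\le c\cdot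 t$ everywhere. Theorem. Let $\mathcal C$ be an effectively compact class of measures on $\Omega$. (a) There is a universal $\mathcal C$-test. (b) Universal uniform tests exist, and for every universal uniform test $\mathbf t(\omega,P)$ the function $\omega\mapsto\inf_{P\in\mathcal C}\mathbf t(\omega,P)$ is a universal $\mathcal C$-test. Hence for every universal $\mathcal C$-test $\mathbf t_{\mathcal C}$ there is a finite constant $c$ such that, for all $\omega\in\Omega$, $$\mathbf t_{\mathcal C}(\omega)\le c\cdot\inf_{P\in\mathcal C}\mathbf t(\omega,P)\quad\text{and}\quad \inf_{P\in\mathcal C}\mathbf t(\omega,P)\le c\cdot\mathbf t_{\mathcal C}(\omega).$$ -/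

import Mathlib

open MeasureTheory
open scoped NNReal ENNReal

namespace AlgRandom

/-- The Cantor space `Ω` of infinite binary sequences, with the product topology and the
product (= Borel) σ-algebra. -/
abbrev Cantor : Type := ℕ → Bool

/-- Probability measures on `Ω`. Their weak topology is the one generated by the sets
`{P | u < P(yΩ) < v}`. -/
abbrev Meas : Type := ProbabilityMeasure Cantor

/-- The interval `xΩ`: all sequences that begin with the finite word `x`. -/
def cyl (x : List Bool) : Set Cantor := {ω | ∀ i : Fin x.length, ω i = x.get i}

/-- Finite presentations of rational numbers: `(a, b, c)` presents `(a - b) / (c + 1)`. -/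
abbrev RatCode : Type := ℕ × ℕ × ℕ

/-- The rational number with a given presentation. -/
def RatCode.val (r : RatCode) : ℚ := ((r.1 : ℚ) - (r.2.1 : ℚ)) / ((r.2.2 : ℚ) + 1)

/-- A condition `u < P(yΩ) < v` on a measure, coded as `(y, u, v)`. -/
abbrev CondCode : Type := List Bool × RatCode × RatCode

/-- The measure `P` satisfies the condition `(y, u, v)`. -/
def CondCode.Holds (b : CondCode) (P : Meas) : Prop :=
  ((RatCode.val b.2.1 : ℚ) : ℝ) < ((P (cyl b.1) : ℝ≥0) : ℝ) ∧
    ((P (cyl b.1) : ℝ≥0) : ℝ) < ((RatCode.val b.2.2 : ℚ) : ℝ)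

/-- The basic open set of measures given by a finite list of conditions. -/
def basicSet (β : List CondCode) : Set Meas := {P | ∀ b ∈ β, CondCode.Holds b P}

/-- `f : Ω → [0,∞]` is lower semicomputable: the sets `{ω | r < f ω}`, `r` rational, are unions
of families of intervals that are enumerable uniformly in `r`. -/
def LowerSemicomputable (f : Cantor → ℝ≥0∞) : Prop :=
  ∃ W : RatCode × List Bool → Prop, REPred W ∧
    ∀ r : RatCode, {ω | (((RatCode.val r : ℚ) : ℝ) : EReal) < (f ω : EReal)} =
      ⋃ x ∈ {x | W (r, x)}, cyl x

/-- `f : Ω × M(Ω) → [0,∞]` is lower semicomputable: the sets `{(ω, P) | r < f(ω, P)}`,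
`r` rational, are unions of families of basic open sets `xΩ × β` that are enumerable
uniformly in `r`. -/
def LowerSemicomputable₂ (f : Cantor → Meas → ℝ≥0∞) : Prop :=
  ∃ W : RatCode × List Bool × List CondCode → Prop, REPred W ∧
    ∀ r : RatCode,
      {z : Cantor × Meas | (((RatCode.val r : ℚ) : ℝ) : EReal) < (f z.1 z.2 : EReal)} =
        ⋃ b ∈ {b : List Bool × List CondCode | W (r, b)}, cyl b.1 ×ˢ basicSet b.2

/-- A uniform test: a lower semicomputable `t(ω, P)` with `∫ t(ω, P) dP(ω) ≤ 1` for all `P`. -/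
def IsUniformTest (t : Cantor → Meas → ℝ≥0∞) : Prop :=
  LowerSemicomputable₂ t ∧ ∀ P : Meas, ∫⁻ ω, t ω P ∂(P : Measure Cantor) ≤ 1

/-- A universal uniform test: maximal among uniform tests up to a constant factor. -/
def IsUniversalUniformTest (t : Cantor → Meas → ℝ≥0∞) : Prop :=
  IsUniformTest t ∧
    ∀ s, IsUniformTest s → ∃ c : ℝ≥0, ∀ ω P, s ω P ≤ (c : ℝ≥0∞) * t ω P

/-- A compact class of measures is effectively compact if the set of finite families of basic
sets that cover it is recursively enumerable. -/
def EffectivelyCompact (C : Set Meas) : Prop :=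
  IsCompact C ∧ REPred fun S : List (List CondCode) => C ⊆ ⋃ β ∈ {β | β ∈ S}, basicSet β

/-- A `C`-test: a lower semicomputable `t(ω)` with `∫ t dP ≤ 1` for all `P ∈ C`. -/
def IsClassTest (C : Set Meas) (t : Cantor → ℝ≥0∞) : Prop :=
  LowerSemicomputable t ∧ ∀ P ∈ C, ∫⁻ ω, t ω ∂(P : Measure Cantor) ≤ 1

/-- A universal `C`-test: maximal among `C`-tests up to a constant factor. -/
def IsUniversalClassTest (C : Set Meas) (t : Cantor → ℝ≥0∞) : Prop :=
  IsClassTest C t ∧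
    ∀ s, IsClassTest C s → ∃ c : ℝ≥0, ∀ ω, s ω ≤ (c : ℝ≥0∞) * t ω

end AlgRandom

/-! The core is a trimming construction. Enumerate all r.e. sets of items `(k, x, β)`, each standing
for the step function `k · 1_{xΩ × β}`, and force each enumeration to have integral at most 3 at
every measure. An item is admitted only on those `P` that satisfy finitely many open conditions
certifying that a finite stage containing it has `P`-integral at most 3. A weighted supremum of the
trimmed functions is a uniform test.

For certificates to exist, the failure of an item's condition at `P` must be visible from open
information, so stages are measured with closed conditions (`closedSup`). Every lower semicomputable
`f` lies below an `openSup` whose `closedSup` is at most `f + 1`. Hence `∫ f dP ≤ 1` gives stage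
integrals at most 2, and the gap between 2 and 3 leaves room for a finite rational certificate
(`exists_certifies`).

Trimming acts on each `P` separately: if `∫ f(·, P) dP ≤ 1` at one `P`, then `f ≤ c · universalTest`
at that `P`, with `c` independent of `P` (`exists_le_mul_universalTest`). A `C`-test, read as a
function of `(ω, P)` constant in `P`, is bounded in this way for all `P ∈ C`; taking the infimum
gives universality. That the infimum is itself a `C`-test needs effective compactness: strict lower
bounds over all of `C` are witnessed by finite covers, which can be enumerated
(`LowerSemicomputable₂.iInf`). -/

section RecursivelyEnumerable

/-! ### Closure properties and a universal enumeration of r.e. predicates -/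

variable {α β : Type*} [Primcodable α] [Primcodable β]

theorem PrimrecPred.re {p : α → Prop} (h : PrimrecPred p) : REPred p := by
  classical
  exact ComputablePred.to_re ⟨inferInstance, (Primrec.to_comp h.decide :)⟩

/-- Halting within `n` steps is primitive recursive and monotone in `n`. The monotonicity lets
finitely many step bounds be merged into one, as conjunction and bounded quantification require. -/
theorem REPred.exists_primrecRel {p : α → Prop} (h : REPred p) :
    ∃ q : α → ℕ → Prop, PrimrecRel q ∧ (∀ a m n, m ≤ n → q a m → q a n) ∧
      ∀ a, p a ↔ ∃ n, q a n := by
  obtain ⟨c, hc⟩ := Nat.Partrec.Code.exists_code.1 h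
  refine ⟨fun a n => (Nat.Partrec.Code.evaln n c (Encodable.encode a)).isSome = true, ?_, ?_, ?_⟩
  · refine PrimrecRel.comp Primrec.eq (f := fun x : α × ℕ =>
      (Nat.Partrec.Code.evaln x.2 c (Encodable.encode x.1)).isSome) ?_ (Primrec.const true)
    exact Primrec.option_isSome.comp (Nat.Partrec.Code.primrec_evaln.comp
      ((Primrec.snd.pair (Primrec.const c)).pair (Primrec.encode.comp Primrec.fst)))
  · intro a m n hmn hm
    obtain ⟨x, hx⟩ := Option.isSome_iff_exists.1 hm
    exact Option.isSome_iff_exists.2 ⟨x, Nat.Partrec.Code.evaln_mono hmn hx⟩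
  · intro a
    have key : p a ↔ ∃ x, x ∈ c.eval (Encodable.encode a) := by
      rw [hc]; simp
    rw [key]
    simp only [Nat.Partrec.Code.evaln_complete, Option.isSome_iff_exists, Option.mem_def]
    exact exists_comm

theorem REPred.of_exists_primrecRel {p : α → Prop} {q : α → ℕ → Prop} (hq : PrimrecRel q)
    (h : ∀ a, p a ↔ ∃ n, q a n) : REPred p := by
  classical
  have hd : Computable₂ fun a n => decide (q a n) := (Primrec.to_comp hq.decide :)
  have := (Partrec.rfind (p := fun a n => Part.some (decide (q a n))) hd.partrec₂).dom_re
  refine this.of_eq fun a => ?_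
  rw [h a]
  refine Nat.rfind_dom.trans ?_
  simp

theorem REPred.comp {p : β → Prop} (h : REPred p) {f : α → β} (hf : Computable f) :
    REPred fun a => p (f a) :=
  Partrec.comp (f := fun b => Part.assert (p b) fun _ => Part.some ()) h hf

/-- Dovetailing: a single number codes both a candidate `b` and a step bound. -/
theorem REPred.ex {p : α → β → Prop} (h : REPred fun x : α × β => p x.1 x.2) :
    REPred fun a => ∃ b, p a b := by
  obtain ⟨q, hq, -, hpq⟩ := h.exists_primrecRel
  refine REPred.of_exists_primrecRel (q := fun a n => ∃ b ∈ (Encodable.decode (α := β) n.unpair.1).toList,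
    q (a, b) n.unpair.2) ?_ ?_
  · have hR : PrimrecRel fun (b : β) (y : α × ℕ) => q (y.1, b) y.2 :=
      hq.comp ((Primrec.fst.comp Primrec.snd).pair Primrec.fst) (Primrec.snd.comp Primrec.snd)
    exact hR.exists_mem_list.comp (f := fun x : α × ℕ =>
        (Encodable.decode (α := β) x.2.unpair.1).toList) (g := fun x => (x.1, x.2.unpair.2))
      (Primrec.optionToList.comp (Primrec.decode.comp (Primrec.fst.comp
        (Primrec.unpair.comp Primrec.snd))))
      (Primrec.fst.pair (Primrec.snd.comp (Primrec.unpair.comp Primrec.snd)))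
  · intro a
    constructor
    · rintro ⟨b, hb⟩
      obtain ⟨n, hn⟩ := (hpq (a, b)).1 hb
      exact ⟨Nat.pair (Encodable.encode b) n, b, by simp, by simpa using hn⟩
    · rintro ⟨n, b, -, hb⟩
      exact ⟨b, (hpq (a, b)).2 ⟨_, hb⟩⟩

theorem REPred.and {p q : α → Prop} (hp : REPred p) (hq : REPred q) :
    REPred fun a => p a ∧ q a := by
  obtain ⟨p', hp', hm, h⟩ := hp.exists_primrecRel
  obtain ⟨q', hq', hm', h'⟩ := hq.exists_primrecRel
  refine REPred.of_exists_primrecRel (q := fun a n => p' a n ∧ q' a n)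
    (PrimrecPred.and hp' hq') fun a => ?_
  rw [h, h']
  constructor
  · rintro ⟨⟨m, hm1⟩, n, hn⟩
    exact ⟨max m n, hm _ _ _ (le_max_left _ _) hm1, hm' _ _ _ (le_max_right _ _) hn⟩
  · rintro ⟨n, h1, h2⟩
    exact ⟨⟨n, h1⟩, n, h2⟩

theorem REPred.or {p q : α → Prop} (hp : REPred p) (hq : REPred q) :
    REPred fun a => p a ∨ q a := by
  obtain ⟨p', hp', -, h⟩ := hp.exists_primrecRel
  obtain ⟨q', hq', -, h'⟩ := hq.exists_primrecRel
  refine REPred.of_exists_primrecRel (q := fun a n => p' a n ∨ q' a n)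
    (PrimrecPred.or hp' hq') fun a => ?_
  rw [h, h', exists_or]

theorem primrecRel_mem_list : PrimrecRel fun (a : α) (l : List α) => a ∈ l :=
  (PrimrecRel.exists_mem_list (R := fun b a : α => b = a) Primrec.eq).swap.of_eq
    fun a l => by simp

theorem REPred.forall_mem {p : α → β → Prop} {l : α → List β} (hl : Primrec l)
    (h : REPred fun x : α × β => p x.1 x.2) : REPred fun a => ∀ b ∈ l a, p a b := by
  obtain ⟨q, hq, hm, hpq⟩ := h.exists_primrecRel
  refine REPred.of_exists_primrecRel (q := fun a n => ∀ b ∈ l a, q (a, b) n) ?_ ?_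
  · have hR : PrimrecRel fun (b : β) (y : α × ℕ) => q (y.1, b) y.2 :=
      hq.comp ((Primrec.fst.comp Primrec.snd).pair Primrec.fst) (Primrec.snd.comp Primrec.snd)
    exact hR.forall_mem_list.comp (f := fun x : α × ℕ => l x.1) (g := id)
      (hl.comp Primrec.fst) Primrec.id
  · intro a
    constructor
    · intro H
      choose! N hN using fun b hb => (hpq (a, b)).1 (H b hb)
      obtain ⟨M, hM⟩ : ∃ M, ∀ b ∈ l a, N b ≤ M :=
        ⟨((l a).map N).sum, fun b hb => List.le_sum_of_mem (List.mem_map_of_mem hb)⟩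
      exact ⟨M, fun b hb => hm _ _ _ (hM b hb) (hN b hb)⟩
    · rintro ⟨n, hn⟩ b hb
      exact (hpq (a, b)).2 ⟨n, hn b hb⟩

theorem REPred.exists_mem {p : α → β → Prop} {l : α → List β} (hl : Primrec l)
    (h : REPred fun x : α × β => p x.1 x.2) : REPred fun a => ∃ b ∈ l a, p a b :=
  REPred.ex (p := fun a b => b ∈ l a ∧ p a b) <| REPred.and
    (PrimrecPred.re <| primrecRel_mem_list.comp Primrec.snd (hl.comp Primrec.fst)) h

/-- A primitive recursive sequence of enumerations that contains an enumeration of every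
recursively enumerable predicate. -/
def universalEnum (α : Type*) [Primcodable α] (e n : ℕ) : Option α :=
  (Nat.Partrec.Code.evaln n.unpair.1 (Denumerable.ofNat Nat.Partrec.Code e) n.unpair.2).bind
    fun _ => Encodable.decode n.unpair.2

theorem primrec_universalEnum : Primrec₂ (universalEnum α) := by
  have hu : Primrec fun x : ℕ × ℕ => x.2.unpair := Primrec.unpair.comp Primrec.snd
  refine Primrec.option_bind (f := fun x : ℕ × ℕ => Nat.Partrec.Code.evaln x.2.unpair.1
    (Denumerable.ofNat Nat.Partrec.Code x.1) x.2.unpair.2) ?_ ?_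
  · exact Nat.Partrec.Code.primrec_evaln.comp (((Primrec.fst.comp hu).pair
      ((Primrec.ofNat _).comp Primrec.fst)).pair (Primrec.snd.comp hu))
  · exact (Primrec.decode.comp (Primrec.snd.comp (hu.comp Primrec.fst)))

theorem REPred.exists_universalEnum {p : α → Prop} (h : REPred p) :
    ∃ e, ∀ a, p a ↔ ∃ n, universalEnum α e n = some a := by
  obtain ⟨c, hc⟩ := Nat.Partrec.Code.exists_code.1 h
  refine ⟨Encodable.encode c, fun a => ?_⟩
  -- The program halts only on codes of elements satisfying `p`, so decoding an input on which it
  -- halts is sound.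
  have hev (m : ℕ) (x : ℕ) : x ∈ c.eval m → ∃ b, Encodable.decode (α := α) m = some b ∧ p b := by
    rw [hc]
    simp only [Part.mem_bind_iff]
    rintro ⟨b, hb, hx⟩
    refine ⟨b, by simpa using hb, ?_⟩
    simp at hx
    exact hx.1
  constructor
  · intro ha
    have : ∃ x, x ∈ c.eval (Encodable.encode a) := by rw [hc]; simpa using ha
    obtain ⟨x, hx⟩ := this
    obtain ⟨k, hk⟩ := Nat.Partrec.Code.evaln_complete.1 hx
    refine ⟨Nat.pair k (Encodable.encode a), ?_⟩
    simp [universalEnum, Option.mem_def.1 hk]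
  · rintro ⟨n, hn⟩
    simp only [universalEnum, Denumerable.ofNat_encode, Option.bind_eq_some_iff] at hn
    obtain ⟨x, hx, hd⟩ := hn
    obtain ⟨b, hb, hpb⟩ := hev _ _ (Nat.Partrec.Code.evaln_sound (Option.mem_def.2 hx))
    rw [hd] at hb
    cases hb
    exact hpb

end RecursivelyEnumerable

namespace AlgRandom

/-! ### Cylinders and basic sets -/

theorem mem_cyl_iff {x : List Bool} {ω : Cantor} :
    ω ∈ cyl x ↔ ∀ i, ∀ h : i < x.length, ω i = x[i] := by
  simp only [cyl, Set.mem_ofPred_eq, List.get_eq_getElem]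
  exact ⟨fun h i hi => h ⟨i, hi⟩, fun h i => h i i.2⟩

/-- The prefix of length `n` of an infinite sequence. -/
def initSeg (ω : Cantor) (n : ℕ) : List Bool := (List.range n).map ω

@[simp] theorem length_initSeg (ω : Cantor) (n : ℕ) : (initSeg ω n).length = n := by
  simp [initSeg]

theorem mem_cyl_iff_initSeg {x : List Bool} {ω : Cantor} :
    ω ∈ cyl x ↔ initSeg ω x.length = x := by
  rw [mem_cyl_iff]
  constructor
  · intro h
    refine List.ext_getElem (by simp) fun i h1 h2 => ?_
    simp [initSeg, h i h2]
  · intro h i hi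
    have : (initSeg ω x.length)[i]'(by simpa using hi) = x[i] := by simp only [h]
    simpa [initSeg] using this

theorem mem_cyl_initSeg (ω : Cantor) (n : ℕ) : ω ∈ cyl (initSeg ω n) := by
  rw [mem_cyl_iff_initSeg]; simp

@[simp] theorem cyl_nil : cyl [] = Set.univ := by
  ext ω; simp [mem_cyl_iff]

theorem cyl_subset_of_prefix {x y : List Bool} (h : x <+: y) : cyl y ⊆ cyl x := by
  intro ω hω
  rw [mem_cyl_iff] at hω ⊢
  intro i hi
  rw [hω i (hi.trans_le h.length_le), h.getElem hi]

theorem take_initSeg (ω : Cantor) {m n : ℕ} (h : m ≤ n) :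
    (initSeg ω n).take m = initSeg ω m := by
  simp [initSeg, ← List.map_take, List.take_range, h]

theorem prefix_initSeg {x : List Bool} {ω : Cantor} {n : ℕ} (hn : x.length ≤ n)
    (h : ω ∈ cyl x) : x <+: initSeg ω n := by
  rw [mem_cyl_iff_initSeg] at h
  rw [← h, ← take_initSeg ω (by simpa using hn)]
  exact List.take_prefix _ _

theorem isClopen_cyl (x : List Bool) : IsClopen (cyl x) := by
  have : cyl x = ⋂ i : Fin x.length, (fun ω : Cantor => ω i) ⁻¹' {x.get i} := by
    ext ω; simp [cyl]
  rw [this]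
  exact isClopen_iInter_of_finite fun i =>
    (isClopen_discrete _).preimage (continuous_apply (i : ℕ))

theorem measurableSet_cyl (x : List Bool) : MeasurableSet (cyl x) :=
  (isClopen_cyl x).isOpen.measurableSet

theorem continuous_apply_cyl (x : List Bool) :
    Continuous fun P : Meas => ((P (cyl x) : ℝ≥0) : ℝ) := by
  refine NNReal.continuous_coe.comp (continuous_iff_continuousAt.2 fun P => ?_)
  exact ProbabilityMeasure.tendsto_measure_of_isClopen_of_tendsto Filter.tendsto_id (isClopen_cyl x)

theorem isOpen_basicSet (β : List CondCode) : IsOpen (basicSet β) := by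
  have : basicSet β = ⋂ b ∈ β.toFinset, {P | CondCode.Holds b P} := by
    ext P; simp [basicSet]
  rw [this]
  exact isOpen_biInter_finset fun b _ =>
    (isOpen_lt continuous_const (continuous_apply_cyl _)).inter
      (isOpen_lt (continuous_apply_cyl _) continuous_const)

@[simp] theorem basicSet_nil : basicSet [] = Set.univ := by
  ext P; simp [basicSet]

theorem basicSet_anti {β γ : List CondCode} (h : β ⊆ γ) : basicSet γ ⊆ basicSet β :=
  fun _ hP b hb => hP b (h hb)

theorem disjoint_cyl_of_length_eq {x y : List Bool} (h : x.length = y.length) (hxy : x ≠ y) :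
    Disjoint (cyl x) (cyl y) := by
  refine Set.disjoint_left.2 fun ω hx hy => hxy ?_
  rw [mem_cyl_iff_initSeg] at hx hy
  rw [← hx, ← hy, h]

/-! ### Rational codes -/

/-- Clearing denominators and moving negative parts across leaves a comparison of natural numbers,
which is visibly primitive recursive. -/
theorem RatCode.val_lt_val_iff (r s : RatCode) : r.val < s.val ↔
    r.1 * (s.2.2 + 1) + s.2.1 * (r.2.2 + 1) < s.1 * (r.2.2 + 1) + r.2.1 * (s.2.2 + 1) := by
  simp only [RatCode.val]
  rw [div_lt_div_iff₀ (by positivity) (by positivity)]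
  have : ((r.1 * (s.2.2 + 1) + s.2.1 * (r.2.2 + 1) : ℕ) : ℚ) <
      ((s.1 * (r.2.2 + 1) + r.2.1 * (s.2.2 + 1) : ℕ) : ℚ) ↔ _ := Nat.cast_lt
  rw [← this]
  push_cast
  constructor <;> intro h <;> linarith

theorem RatCode.val_surjective : Function.Surjective RatCode.val := by
  intro q
  refine ⟨(q.num.toNat, (-q.num).toNat, q.den - 1), ?_⟩
  have h1 : (((q.den - 1 : ℕ) : ℚ) + 1) = q.den := by
    have := q.den_pos
    rw [← Nat.cast_succ, Nat.succ_eq_add_one, Nat.sub_add_cancel this]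
  have h2 : ((q.num.toNat : ℚ) - ((-q.num).toNat : ℚ)) = q.num := by
    have := Int.toNat_sub_toNat_neg q.num
    exact_mod_cast this
  simp only [RatCode.val, h1, h2]
  exact Rat.num_div_den q

theorem primrecRel_val_lt : PrimrecRel fun r s : RatCode => r.val < s.val := by
  have h {f g h k : RatCode × RatCode → ℕ} (hf : Primrec f) (hg : Primrec g) (hh : Primrec h)
      (hk : Primrec k) : Primrec fun x => f x * (g x + 1) + h x * (k x + 1) :=
    Primrec.nat_add.comp (Primrec.nat_mul.comp hf (Primrec.succ.comp hg))
      (Primrec.nat_mul.comp hh (Primrec.succ.comp hk))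
  have p1 : Primrec fun x : RatCode × RatCode => x.1.1 := Primrec.fst.comp Primrec.fst
  have p2 : Primrec fun x : RatCode × RatCode => x.1.2.1 :=
    Primrec.fst.comp (Primrec.snd.comp Primrec.fst)
  have p3 : Primrec fun x : RatCode × RatCode => x.1.2.2 :=
    Primrec.snd.comp (Primrec.snd.comp Primrec.fst)
  have q1 : Primrec fun x : RatCode × RatCode => x.2.1 := Primrec.fst.comp Primrec.snd
  have q2 : Primrec fun x : RatCode × RatCode => x.2.2.1 :=
    Primrec.fst.comp (Primrec.snd.comp Primrec.snd)
  have q3 : Primrec fun x : RatCode × RatCode => x.2.2.2 :=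
    Primrec.snd.comp (Primrec.snd.comp Primrec.snd)
  exact PrimrecRel.of_eq (r := fun r s : RatCode =>
    r.1 * (s.2.2 + 1) + s.2.1 * (r.2.2 + 1) < s.1 * (r.2.2 + 1) + r.2.1 * (s.2.2 + 1))
    (Primrec.nat_lt.comp (h p1 q3 q2 p3) (h q1 p3 p2 q3))
    fun r s => (RatCode.val_lt_val_iff r s).symm

theorem re_prefix : REPred fun x : List Bool × List Bool => x.1 <+: x.2 :=
  REPred.ex (p := fun (x : List Bool × List Bool) t => x.1 ++ t = x.2) <| PrimrecPred.re <|
    Primrec.eq.comp (Primrec.list_append.comp (Primrec.fst.comp Primrec.fst) Primrec.snd)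
      (Primrec.snd.comp Primrec.fst)

/-- All binary words of length `n`. -/
def wordsOfLength : ℕ → List (List Bool)
  | 0 => [[]]
  | n + 1 => (wordsOfLength n).map (List.cons true) ++ (wordsOfLength n).map (List.cons false)

theorem mem_wordsOfLength {n : ℕ} {x : List Bool} : x ∈ wordsOfLength n ↔ x.length = n := by
  induction n generalizing x with
  | zero => simp [wordsOfLength]
  | succ n ih =>
    cases x with
    | nil => simp [wordsOfLength]
    | cons a x => cases a <;> simp [wordsOfLength, ih]

theorem nodup_wordsOfLength (n : ℕ) : (wordsOfLength n).Nodup := by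
  induction n with
  | zero => simp [wordsOfLength]
  | succ n ih =>
    refine List.Nodup.append (ih.map (List.cons_injective)) (ih.map (List.cons_injective)) ?_
    intro x hx hy
    simp only [List.mem_map] at hx hy
    obtain ⟨y, -, rfl⟩ := hx
    obtain ⟨z, -, h⟩ := hy
    simp at h

theorem primrec_wordsOfLength : Primrec wordsOfLength := by
  refine (Primrec.nat_rec₁ (f := fun _ (l : List (List Bool)) =>
    l.map (List.cons true) ++ l.map (List.cons false)) [[]] ?_).of_eq fun n => ?_
  · exact Primrec.list_append.comp
      (Primrec.list_map Primrec.snd (Primrec.list_cons.comp (Primrec.const true) Primrec.snd))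
      (Primrec.list_map Primrec.snd (Primrec.list_cons.comp (Primrec.const false) Primrec.snd))
  · induction n with
    | zero => rfl
    | succ n ih => simp only [wordsOfLength, ← ih]

/-! ### Closed conditions -/

/-- The closed set of measures obtained by weakening all inequalities of `basicSet β`. -/
def closedSet (β : List CondCode) : Set Meas :=
  {P | ∀ b ∈ β, ((RatCode.val b.2.1 : ℚ) : ℝ) ≤ ((P (cyl b.1) : ℝ≥0) : ℝ) ∧
    ((P (cyl b.1) : ℝ≥0) : ℝ) ≤ ((RatCode.val b.2.2 : ℚ) : ℝ)}

theorem basicSet_subset_closedSet (β : List CondCode) : basicSet β ⊆ closedSet β :=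
  fun _ hP b hb => ⟨(hP b hb).1.le, (hP b hb).2.le⟩

/-- Every condition of `β` is implied by a condition of `β'` with strictly narrower bounds. -/
def StronglyInside (β' β : List CondCode) : Prop :=
  ∀ b ∈ β, ∃ b' ∈ β', b'.1 = b.1 ∧ b.2.1.val < b'.2.1.val ∧ b'.2.2.val < b.2.2.val

/-- The strict narrowing absorbs the weakening of `<` to `≤`; this is what keeps `closedSup` close
to the original function. -/
theorem StronglyInside.closedSet_subset {β' β : List CondCode} (h : StronglyInside β' β) :
    closedSet β' ⊆ basicSet β := by
  intro P hP b hb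
  obtain ⟨b', hb', h1, h2, h3⟩ := h b hb
  have := hP b' hb'
  rw [h1] at this
  exact ⟨lt_of_lt_of_le (by exact_mod_cast h2) this.1,
    lt_of_le_of_lt this.2 (by exact_mod_cast h3)⟩

theorem exists_stronglyInside {β : List CondCode} {P : Meas} (h : P ∈ basicSet β) :
    ∃ β', StronglyInside β' β ∧ P ∈ basicSet β' := by
  have key : ∀ b ∈ β, ∃ b' : CondCode, b'.1 = b.1 ∧ b.2.1.val < b'.2.1.val ∧
      b'.2.2.val < b.2.2.val ∧ b'.Holds P := by
    intro b hb
    obtain ⟨q, hq1, hq2⟩ := exists_rat_btwn (h b hb).1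
    obtain ⟨q', hq1', hq2'⟩ := exists_rat_btwn (h b hb).2
    obtain ⟨r, rfl⟩ := RatCode.val_surjective q
    obtain ⟨r', rfl⟩ := RatCode.val_surjective q'
    exact ⟨(b.1, r, r'), rfl, by exact_mod_cast hq1, by exact_mod_cast hq2', hq2, hq1'⟩
  choose! f h1 h2 h3 h4 using key
  refine ⟨β.map f, fun b hb => ⟨f b, List.mem_map_of_mem hb, h1 b hb, h2 b hb, h3 b hb⟩, ?_⟩
  intro b hb
  obtain ⟨c, hc, rfl⟩ := List.mem_map.1 hb
  exact h4 c hc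

/-- The conditions `γ` visibly contradict `β`. -/
def Refutes (γ β : List CondCode) : Prop :=
  ∃ b ∈ β, ∃ c ∈ γ, c.1 = b.1 ∧ (c.2.2 = b.2.1 ∨ c.2.1 = b.2.2)

theorem Refutes.mono {γ γ' β : List CondCode} (h : Refutes γ β) (hγ : γ ⊆ γ') :
    Refutes γ' β := by
  obtain ⟨b, hb, c, hc, h⟩ := h
  exact ⟨b, hb, c, hγ hc, h⟩

theorem Refutes.notMem_closedSet {γ β : List CondCode} (h : Refutes γ β) {P : Meas}
    (hP : P ∈ basicSet γ) : P ∉ closedSet β := by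
  intro hβ
  obtain ⟨b, hb, c, hc, h1, h2⟩ := h
  have hb := hβ b hb
  have hc := hP c hc
  rw [CondCode.Holds, h1] at hc
  rcases h2 with h2 | h2 <;> rw [h2] at hc
  · exact absurd hc.2 (not_lt.2 hb.1)
  · exact absurd hc.1 (not_lt.2 hb.2)

theorem RatCode.val_neg_one_lt (P : Meas) (x : List Bool) :
    ((RatCode.val (0, 1, 0) : ℚ) : ℝ) < ((P (cyl x) : ℝ≥0) : ℝ) := by
  have : ((RatCode.val (0, 1, 0) : ℚ) : ℝ) = -1 := by simp [RatCode.val]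
  rw [this]
  linarith [(P (cyl x)).coe_nonneg]

theorem RatCode.lt_val_two (P : Meas) (x : List Bool) :
    ((P (cyl x) : ℝ≥0) : ℝ) < ((RatCode.val (2, 0, 0) : ℚ) : ℝ) := by
  have : ((RatCode.val (2, 0, 0) : ℚ) : ℝ) = 2 := by simp [RatCode.val]
  rw [this]
  have : ((P (cyl x) : ℝ≥0) : ℝ) ≤ 1 := by exact_mod_cast P.apply_le_one _
  linarith

/-- The complement of a closed condition is open, so its failure is witnessed by one strict
inequality. Reusing the violated bound's own code suffices, so `Refutes` may compare codes instead
of values. -/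
theorem exists_refutes {β : List CondCode} {P : Meas} (h : P ∉ closedSet β) :
    ∃ γ, Refutes γ β ∧ P ∈ basicSet γ := by
  simp only [closedSet, Set.mem_ofPred_eq, not_forall, not_and_or, not_le] at h
  obtain ⟨b, hb, h | h⟩ := h
  -- The unused side of the condition is filled with -1 here, and with 2 in the other case; every
  -- probability satisfies these.
  · refine ⟨[(b.1, (0, 1, 0), b.2.1)], ⟨b, hb, _, List.mem_singleton_self _, rfl, .inl rfl⟩, ?_⟩
    intro c hc
    rw [List.mem_singleton.1 hc]
    exact ⟨RatCode.val_neg_one_lt _ _, h⟩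
  · refine ⟨[(b.1, b.2.2, (2, 0, 0))], ⟨b, hb, _, List.mem_singleton_self _, rfl, .inr rfl⟩, ?_⟩
    intro c hc
    rw [List.mem_singleton.1 hc]
    exact ⟨h, RatCode.lt_val_two _ _⟩

/-! ### Step functions -/

/-- A triple `(k, x, β)`: the function that is `k` on `xΩ × β`, and `0` elsewhere. -/
abbrev Item : Type := ℕ × List Bool × List CondCode

/-- The supremum of the functions `k · 1_{xΩ × β}` over the items `(k, x, β)` in `T`. -/
noncomputable def openSup (T : Item → Prop) (ω : Cantor) (P : Meas) : ℝ≥0∞ :=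
  ⨆ (i : Item) (_ : T i) (_ : P ∈ basicSet i.2.2),
    (cyl i.2.1).indicator (fun _ => (i.1 : ℝ≥0∞)) ω

/-- As `openSup`, with closed conditions. -/
noncomputable def closedSup (T : Item → Prop) (ω : Cantor) (P : Meas) : ℝ≥0∞ :=
  ⨆ (i : Item) (_ : T i) (_ : P ∈ closedSet i.2.2),
    (cyl i.2.1).indicator (fun _ => (i.1 : ℝ≥0∞)) ω

theorem measurable_openSup (T : Item → Prop) (P : Meas) :
    Measurable fun ω => openSup T ω P :=
  .iSup fun _ => .iSup fun _ => .iSup fun _ => measurable_const.indicator (measurableSet_cyl _)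

theorem measurable_closedSup (T : Item → Prop) (P : Meas) :
    Measurable fun ω => closedSup T ω P :=
  .iSup fun _ => .iSup fun _ => .iSup fun _ => measurable_const.indicator (measurableSet_cyl _)

theorem lt_openSup_iff {T : Item → Prop} {ω : Cantor} {P : Meas} {a : ℝ≥0∞} :
    a < openSup T ω P ↔
      ∃ i, T i ∧ ω ∈ cyl i.2.1 ∧ P ∈ basicSet i.2.2 ∧ a < (i.1 : ℝ≥0∞) := by
  simp only [openSup, lt_iSup_iff, exists_prop]
  refine exists_congr fun i => and_congr_right fun _ => ?_
  by_cases h : ω ∈ cyl i.2.1 <;> simp [h]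

theorem le_openSup {T : Item → Prop} {ω : Cantor} {P : Meas} {i : Item} (hi : T i)
    (hω : ω ∈ cyl i.2.1) (hP : P ∈ basicSet i.2.2) : (i.1 : ℝ≥0∞) ≤ openSup T ω P := by
  have : (i.1 : ℝ≥0∞) = (cyl i.2.1).indicator (fun _ => (i.1 : ℝ≥0∞)) ω := by simp [hω]
  rw [this]
  exact le_iSup_of_le i (le_iSup_of_le hi (le_iSup_of_le hP le_rfl))

theorem le_closedSup {T : Item → Prop} {ω : Cantor} {P : Meas} {i : Item} (hi : T i)
    (hω : ω ∈ cyl i.2.1) (hP : P ∈ closedSet i.2.2) : (i.1 : ℝ≥0∞) ≤ closedSup T ω P := by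
  have : (i.1 : ℝ≥0∞) = (cyl i.2.1).indicator (fun _ => (i.1 : ℝ≥0∞)) ω := by simp [hω]
  rw [this]
  exact le_iSup_of_le i (le_iSup_of_le hi (le_iSup_of_le hP le_rfl))

theorem openSup_le {T : Item → Prop} {ω : Cantor} {P : Meas} {a : ℝ≥0∞}
    (h : ∀ i, T i → ω ∈ cyl i.2.1 → P ∈ basicSet i.2.2 → (i.1 : ℝ≥0∞) ≤ a) :
    openSup T ω P ≤ a :=
  iSup_le fun i => iSup₂_le fun hi hP =>
    Set.indicator_apply_le' (fun hω => h i hi hω hP) fun _ => zero_le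

theorem closedSup_le {T : Item → Prop} {ω : Cantor} {P : Meas} {a : ℝ≥0∞}
    (h : ∀ i, T i → ω ∈ cyl i.2.1 → P ∈ closedSet i.2.2 → (i.1 : ℝ≥0∞) ≤ a) :
    closedSup T ω P ≤ a :=
  iSup_le fun i => iSup₂_le fun hi hP =>
    Set.indicator_apply_le' (fun hω => h i hi hω hP) fun _ => zero_le

theorem closedSup_mono {T T' : Item → Prop} (h : ∀ i, T i → T' i) (ω : Cantor) (P : Meas) :
    closedSup T ω P ≤ closedSup T' ω P :=
  closedSup_le fun i hi hω hP => le_closedSup (h i hi) hω hP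

/-! ### Certified bounds of integrals -/

/-- A finite list of triples `(w, k, p)`, presenting the step function `∑ k · 1_{wΩ}` together
with numerators `p` of bounds on the measures of the intervals `wΩ`. -/
abbrev StepList : Type := List (List Bool × ℕ × ℕ)

/-- The step function of a `StepList`. -/
noncomputable def StepList.eval (D : StepList) (ω : Cantor) : ℝ≥0∞ :=
  (D.map fun d => (cyl d.1).indicator (fun _ => (d.2.1 : ℝ≥0∞)) ω).sum

theorem StepList.measurable_eval (D : StepList) : Measurable D.eval := by
  induction D with
  | nil => exact measurable_const
  | cons d D ih => exact (measurable_const.indicator (measurableSet_cyl _)).add ih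

theorem StepList.lintegral_eval (D : StepList) (μ : Measure Cantor) :
    ∫⁻ ω, D.eval ω ∂μ = (D.map fun d => (d.2.1 : ℝ≥0∞) * μ (cyl d.1)).sum := by
  induction D with
  | nil => simp [StepList.eval]
  | cons d D ih =>
    have : StepList.eval (d :: D) = fun ω =>
      (cyl d.1).indicator (fun _ => (d.2.1 : ℝ≥0∞)) ω + StepList.eval D ω := rfl
    rw [this, lintegral_add_right _ (StepList.measurable_eval D), ih,
      lintegral_indicator_const (measurableSet_cyl _)]
    simp

theorem StepList.le_eval {D : StepList} {d : List Bool × ℕ × ℕ} (hd : d ∈ D) {ω : Cantor}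
    (hω : ω ∈ cyl d.1) : (d.2.1 : ℝ≥0∞) ≤ D.eval ω := by
  have : (d.2.1 : ℝ≥0∞) = (cyl d.1).indicator (fun _ => (d.2.1 : ℝ≥0∞)) ω := by simp [hω]
  rw [this]
  exact List.le_sum_of_mem (List.mem_map_of_mem hd)

/-- The step function of `D` is visibly at least `k` on `xΩ`. -/
def StepList.Covers (D : StepList) (k : ℕ) (x : List Bool) : Prop :=
  ∃ m, ∀ v ∈ wordsOfLength m, ∃ d ∈ D, k ≤ d.2.1 ∧ d.1 <+: x ++ v

theorem StepList.Covers.le_eval {D : StepList} {k : ℕ} {x : List Bool} (h : D.Covers k x)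
    {ω : Cantor} (hω : ω ∈ cyl x) : (k : ℝ≥0∞) ≤ D.eval ω := by
  obtain ⟨m, h⟩ := h
  obtain ⟨v, hv⟩ := prefix_initSeg (Nat.le_add_right _ m) hω
  obtain ⟨d, hd, hk, hp⟩ := h v (mem_wordsOfLength.2 (by
    have := congrArg List.length hv
    simpa using this))
  refine le_trans (by exact_mod_cast hk) (StepList.le_eval hd (cyl_subset_of_prefix hp ?_))
  rw [hv]
  exact mem_cyl_initSeg _ _

/-- The items that are enumerated by `I` before stage `n`. -/
def Stage (I : ℕ → Option Item) (n : ℕ) (i : Item) : Prop :=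
  ∃ j < n, I j = some i

/-- The conditions `γ` ensure, in a finitely verifiable way, that the integral of the `n`-th stage
of `I` is at most `3`. -/
def Certifies (I : ℕ → Option Item) (n : ℕ) (γ : List CondCode) : Prop :=
  ∃ (D : StepList) (N : ℕ), (∀ d ∈ D, ∃ c ∈ γ, c.1 = d.1 ∧ c.2.2 = (d.2.2, 0, N)) ∧
    (D.map fun d => d.2.1 * d.2.2).sum ≤ 3 * (N + 1) ∧
    ∀ j ∈ List.range n, ∀ i ∈ (I j).toList, Refutes γ i.2.2 ∨ D.Covers i.1 i.2.1

theorem Certifies.mono {I : ℕ → Option Item} {n : ℕ} {γ γ' : List CondCode}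
    (h : Certifies I n γ) (hγ : γ ⊆ γ') : Certifies I n γ' := by
  obtain ⟨D, N, h1, h2, h3⟩ := h
  refine ⟨D, N, fun d hd => ?_, h2, fun j hj i hi => (h3 j hj i hi).imp_left (·.mono hγ)⟩
  obtain ⟨c, hc, h⟩ := h1 d hd
  exact ⟨c, hγ hc, h⟩

/-- Items refuted by `γ` are inactive at `P`, and all others lie below the step function of `D`. Its
integral is at most `∑ k · p / (N + 1) ≤ 3`. -/
theorem Certifies.lintegral_le {I : ℕ → Option Item} {n : ℕ} {γ : List CondCode}
    (h : Certifies I n γ) {P : Meas} (hP : P ∈ basicSet γ) :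
    ∫⁻ ω, closedSup (Stage I n) ω P ∂(P : Measure Cantor) ≤ 3 := by
  obtain ⟨D, N, h1, h2, h3⟩ := h
  have hle : ∫⁻ ω, closedSup (Stage I n) ω P ∂(P : Measure Cantor) ≤
      ∫⁻ ω, D.eval ω ∂(P : Measure Cantor) := by
    refine lintegral_mono fun ω => closedSup_le ?_
    rintro i ⟨j, hj, hi⟩ hω hc
    rcases h3 j (List.mem_range.2 hj) i (by simp [hi]) with h | h
    · exact absurd hc (h.notMem_closedSet hP)
    · exact h.le_eval hω
  refine hle.trans ?_
  rw [StepList.lintegral_eval]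
  -- Multiplying through by `N + 1` avoids division; sublists make the induction keep access to the
  -- bounds in `γ`.
  have key : ∀ D' ⊆ D, ((N + 1 : ℕ) : ℝ≥0∞) *
      (D'.map fun d => (d.2.1 : ℝ≥0∞) * (P : Measure Cantor) (cyl d.1)).sum ≤
      ((D'.map fun d => d.2.1 * d.2.2).sum : ℕ) := by
    intro D' hD'
    induction D' with
    | nil => simp
    | cons d D' ih =>
      have ih := ih fun x hx => hD' (List.mem_cons_of_mem _ hx)
      rw [List.map_cons, List.map_cons, List.sum_cons, List.sum_cons, mul_add,
        Nat.cast_add (d.2.1 * d.2.2)]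
      refine add_le_add ?_ ih
      obtain ⟨c, hc, hc1, hc2⟩ := h1 d (hD' List.mem_cons_self)
      have hb := (hP c hc).2
      rw [hc1, hc2] at hb
      have hb' : ((N : ℝ) + 1) * ((P (cyl d.1) : ℝ≥0) : ℝ) ≤ d.2.2 := by
        simp only [RatCode.val] at hb
        push_cast at hb
        rw [lt_div_iff₀ (by positivity)] at hb
        linarith
      have hb2 : ((N + 1 : ℕ) : ℝ≥0∞) * (P : Measure Cantor) (cyl d.1) ≤ (d.2.2 : ℕ) := by
        rw [← ProbabilityMeasure.ennreal_coeFn_eq_coeFn_toMeasure]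
        have : ((N + 1 : ℕ) : ℝ≥0) * (P (cyl d.1) : ℝ≥0) ≤ (d.2.2 : ℕ) := by
          rw [← NNReal.coe_le_coe]; push_cast; exact hb'
        exact_mod_cast this
      calc ((N + 1 : ℕ) : ℝ≥0∞) * ((d.2.1 : ℝ≥0∞) * (P : Measure Cantor) (cyl d.1))
          = d.2.1 * (((N + 1 : ℕ) : ℝ≥0∞) * (P : Measure Cantor) (cyl d.1)) := by ring
        _ ≤ d.2.1 * (d.2.2 : ℕ) := by gcongr
        _ = _ := by push_cast; rfl
  have h4 := (key D (List.Subset.refl _)).trans (Nat.cast_le.2 h2)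
  rw [mul_comm 3, Nat.cast_mul] at h4
  exact_mod_cast (ENNReal.mul_le_mul_iff_right (by simp) (by finiteness)).1 h4

theorem finite_stage (I : ℕ → Option Item) (n : ℕ) : {i | Stage I n i}.Finite := by
  have : {i | Stage I n i} ⊆ ⋃ j ∈ Finset.range n, {i | I j = some i} := by
    rintro i ⟨j, hj, hi⟩
    simp only [Set.mem_iUnion]
    exact ⟨j, Finset.mem_range.2 hj, hi⟩
  refine Set.Finite.subset (Set.Finite.biUnion (Finset.finite_toSet _) fun j _ => ?_) this
  exact Set.Subsingleton.finite fun a ha b hb => Option.some_injective _ (ha.symm.trans hb)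

/-- The words of length `M` partition `Ω`, so at each point only one summand of the step function is
active. -/
theorem sum_mul_measure_cyl_le {M : ℕ} (h : List Bool → ℕ) {f : Cantor → ℝ≥0∞}
    (hf : ∀ w ∈ wordsOfLength M, ∀ ω ∈ cyl w, (h w : ℝ≥0∞) ≤ f ω) (μ : Measure Cantor) :
    ∑ w ∈ (wordsOfLength M).toFinset, (h w : ℝ≥0∞) * μ (cyl w) ≤ ∫⁻ ω, f ω ∂μ := by
  calc ∑ w ∈ (wordsOfLength M).toFinset, (h w : ℝ≥0∞) * μ (cyl w)
      = ∫⁻ ω, ∑ w ∈ (wordsOfLength M).toFinset,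
          (cyl w).indicator (fun _ => (h w : ℝ≥0∞)) ω ∂μ := by
        rw [lintegral_finsetSum _ fun w _ => measurable_const.indicator (measurableSet_cyl w)]
        simp only [lintegral_indicator_const (measurableSet_cyl _)]
    _ ≤ _ := by
        refine lintegral_mono fun ω => ?_
        have hmem : initSeg ω M ∈ wordsOfLength M := mem_wordsOfLength.2 (by simp)
        dsimp only
        rw [Finset.sum_eq_single (initSeg ω M)]
        · rw [Set.indicator_of_mem (mem_cyl_initSeg _ _)]
          exact hf _ hmem ω (mem_cyl_initSeg _ _)
        · intro w hw hne
          have hw := mem_wordsOfLength.1 (List.mem_toFinset.1 hw)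
          refine Set.indicator_of_notMem (fun hω => ?_) _
          exact Set.disjoint_left.1 (disjoint_cyl_of_length_eq (by simp [hw]) hne) hω
            (mem_cyl_initSeg _ _)
        · intro hn
          exact absurd (List.mem_toFinset.2 hmem) hn

/-- A finite stage depends only on a prefix of bounded length `M`, so its integral dominates a
finite sum over words of length `M`. Rounding the measures up to rationals uses part of the slack
between 2 and 3; items inactive at `P` are refuted by open conditions. -/
theorem exists_certifies {I : ℕ → Option Item} {n : ℕ} {P : Meas}
    (hI : ∫⁻ ω, closedSup (Stage I n) ω P ∂(P : Measure Cantor) ≤ 2) :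
    ∃ γ, Certifies I n γ ∧ P ∈ basicSet γ := by
  classical
  set A : Finset Item := (finite_stage I n).toFinset
  have hA : ∀ i, i ∈ A ↔ Stage I n i := fun i => by simp [A]
  set M : ℕ := A.sup fun i => i.2.1.length
  set h : List Bool → ℕ := fun w =>
    (A.filter fun i => P ∈ closedSet i.2.2 ∧ i.2.1 <+: w).sup fun i => i.1
  have hle : ∀ i ∈ A, P ∈ closedSet i.2.2 → ∀ w, i.2.1 <+: w → i.1 ≤ h w := fun i hi hP w hw =>
    Finset.le_sup (f := fun i : Item => i.1) (Finset.mem_filter.2 ⟨hi, hP, hw⟩)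
  have hsum := (sum_mul_measure_cyl_le (M := M) h (fun w _ ω hω => ?_) (P : Measure Cantor)).trans hI
  swap
  · rcases (A.filter fun i => P ∈ closedSet i.2.2 ∧ i.2.1 <+: w).eq_empty_or_nonempty with h0 | h0
    · simp [h, h0]
    · obtain ⟨i, hi, hhi⟩ := Finset.exists_mem_eq_sup _ h0 fun i : Item => i.1
      obtain ⟨hi1, hi2, hi3⟩ := Finset.mem_filter.1 hi
      have : h w = i.1 := hhi
      rw [this]
      exact le_closedSup ((hA i).1 hi1) (cyl_subset_of_prefix hi3 hω) hi2
  -- With this denominator, rounding up costs at most `∑ h w = N` in the sum scaled by `N + 1`, that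
  -- is, less than 1 in the integral.
  set N : ℕ := ∑ w ∈ (wordsOfLength M).toFinset, h w
  -- The `+ 1` after the floor makes the upper bound on `P (cyl w)` strict, as open conditions
  -- demand.
  set p : List Bool → ℕ := fun w => ⌊((P (cyl w) : ℝ≥0) : ℝ) * (N + 1)⌋₊ + 1
  have hsumR : ∑ w ∈ (wordsOfLength M).toFinset, (h w : ℝ) * ((P (cyl w) : ℝ≥0) : ℝ) ≤ 2 := by
    have : ∑ w ∈ (wordsOfLength M).toFinset, (h w : ℝ≥0) * (P (cyl w) : ℝ≥0) ≤ 2 := by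
      simp only [← ProbabilityMeasure.ennreal_coeFn_eq_coeFn_toMeasure] at hsum
      exact_mod_cast hsum
    exact_mod_cast this
  have hp : ∑ w ∈ (wordsOfLength M).toFinset, h w * p w ≤ 3 * (N + 1) := by
    have : ∑ w ∈ (wordsOfLength M).toFinset, (h w : ℝ) * (p w : ℝ) ≤ 3 * (N + 1) := by
      calc ∑ w ∈ (wordsOfLength M).toFinset, (h w : ℝ) * (p w : ℝ)
          ≤ ∑ w ∈ (wordsOfLength M).toFinset,
            ((h w : ℝ) * ((P (cyl w) : ℝ≥0) : ℝ) * (N + 1) + h w) := by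
            refine Finset.sum_le_sum fun w _ => ?_
            have h1 : (p w : ℝ) ≤ ((P (cyl w) : ℝ≥0) : ℝ) * (N + 1) + 1 := by
              simp only [p]
              push_cast
              have := Nat.floor_le (a := ((P (cyl w) : ℝ≥0) : ℝ) * (N + 1)) (by positivity)
              linarith
            calc (h w : ℝ) * (p w : ℝ) ≤ h w * (((P (cyl w) : ℝ≥0) : ℝ) * (N + 1) + 1) := by gcongr
              _ = _ := by ring
        _ = (∑ w ∈ (wordsOfLength M).toFinset, (h w : ℝ) * ((P (cyl w) : ℝ≥0) : ℝ)) * (N + 1) + N := by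
            rw [Finset.sum_add_distrib, Finset.sum_mul]
            simp [N]
        _ ≤ 2 * (N + 1) + N := by gcongr
        _ ≤ 3 * (N + 1) := by linarith
    exact_mod_cast this
  have href : ∀ i : Item, P ∉ closedSet i.2.2 → ∃ γ, Refutes γ i.2.2 ∧ P ∈ basicSet γ :=
    fun i hi => exists_refutes hi
  choose! g hg1 hg2 using href
  set γ₁ : List CondCode := (wordsOfLength M).map fun w => (w, (0, 1, 0), (p w, 0, N))
  set γ₂ : List CondCode := (A.filter fun i => P ∉ closedSet i.2.2).toList.flatMap g
  refine ⟨γ₁ ++ γ₂, ⟨(wordsOfLength M).map fun w => (w, h w, p w), N, ?_, ?_, ?_⟩, ?_⟩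
  · intro d hd
    obtain ⟨w, hw, rfl⟩ := List.mem_map.1 hd
    exact ⟨_, List.mem_append_left _ (List.mem_map_of_mem hw), rfl, rfl⟩
  · rw [List.map_map, ← List.sum_toFinset _ (nodup_wordsOfLength M)]
    exact hp
  · intro j hj i hi
    have hiA : i ∈ A := (hA i).2 ⟨j, List.mem_range.1 hj, by simpa using hi⟩
    by_cases hc : P ∈ closedSet i.2.2
    · refine .inr ⟨M, fun v hv => ?_⟩
      have hlen : i.2.1.length ≤ M := Finset.le_sup (f := fun i : Item => i.2.1.length) hiA
      have hw : ((i.2.1 ++ v).take M) ∈ wordsOfLength M :=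
        mem_wordsOfLength.2 (by simp [mem_wordsOfLength.1 hv])
      refine ⟨_, List.mem_map_of_mem hw, hle i hiA hc _ ?_, List.take_prefix _ _⟩
      exact List.prefix_take_iff.2 ⟨List.prefix_append _ _, hlen⟩
    · refine .inl ((hg1 i hc).mono fun c hcc => List.mem_append_right _ ?_)
      exact List.mem_flatMap.2 ⟨i, by simp [hiA, hc], hcc⟩
  · intro b hb
    rcases List.mem_append.1 hb with hb | hb
    · obtain ⟨w, -, rfl⟩ := List.mem_map.1 hb
      refine ⟨RatCode.val_neg_one_lt _ _, ?_⟩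
      have : ((RatCode.val (p w, 0, N) : ℚ) : ℝ) = p w / (N + 1) := by simp [RatCode.val]
      change _ < ((RatCode.val (p w, 0, N) : ℚ) : ℝ)
      rw [this, lt_div_iff₀ (by positivity)]
      simp only [p]
      push_cast
      exact Nat.lt_floor_add_one _
    · obtain ⟨i, hi, hb⟩ := List.mem_flatMap.1 hb
      exact hg2 i (by simpa using And.right (by simpa using hi)) b hb

/-! ### Trimming -/

/-- The items of `I`, each restricted to measures for which the integral of a stage of `I` that
contains it is certified to be at most `3`. -/
def Trimmed (I : ℕ → Option Item) (i : Item) : Prop :=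
  ∃ n, ∃ j ∈ List.range n, ∃ i' ∈ (I j).toList, i.1 = i'.1 ∧ i.2.1 = i'.2.1 ∧
    (∀ b ∈ i'.2.2, b ∈ i.2.2) ∧ Certifies I n i.2.2

/-- At a fixed `P`, only stages certified by conditions true of `P` contribute. They form a chain,
each of integral at most 3, so monotone convergence applies. -/
theorem lintegral_trimmed_le (I : ℕ → Option Item) (P : Meas) :
    ∫⁻ ω, openSup (Trimmed I) ω P ∂(P : Measure Cantor) ≤ 3 := by
  let S := {n : ℕ // ∃ γ, P ∈ basicSet γ ∧ Certifies I n γ}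
  have hle : ∀ ω, openSup (Trimmed I) ω P ≤ ⨆ n : S, closedSup (Stage I n) ω P := by
    refine fun ω => openSup_le ?_
    rintro i ⟨n, j, hj, i', hi', h1, h2, h3, h4⟩ hω hP
    rw [h1]
    refine le_iSup_of_le (⟨n, _, hP, h4⟩ : S) (le_closedSup ⟨j, List.mem_range.1 hj, by
      simpa using hi'⟩ (by rwa [← h2]) (basicSet_subset_closedSet _ (basicSet_anti h3 hP)))
  refine (lintegral_mono hle).trans ?_
  rw [lintegral_iSup_directed (fun n => (measurable_closedSup _ P).aemeasurable)]
  · exact iSup_le fun ⟨n, γ, hP, hγ⟩ => hγ.lintegral_le hP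
  · refine directed_of_isDirected_le fun m n hmn ω => closedSup_mono ?_ _ _
    rintro i ⟨j, hj, hi⟩
    exact ⟨j, lt_of_lt_of_le hj hmn, hi⟩

/-- The integral bound is needed only at the given `P`: every stage then has a certificate valid at
`P`, so trimming loses nothing there. -/
theorem openSup_le_trimmed {I : ℕ → Option Item} {T : Item → Prop}
    (hT : ∀ i, T i ↔ ∃ n, I n = some i) {P : Meas}
    (hP : ∫⁻ ω, closedSup T ω P ∂(P : Measure Cantor) ≤ 2) (ω : Cantor) :
    openSup T ω P ≤ openSup (Trimmed I) ω P := by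
  refine openSup_le fun i hi hω hPi => ?_
  obtain ⟨j, hj⟩ := (hT i).1 hi
  obtain ⟨γ, hγ, hPγ⟩ := exists_certifies (I := I) (n := j + 1) (P := P) <|
    (lintegral_mono fun ω => closedSup_mono (T' := T) (by
      rintro i ⟨j, -, hi⟩
      exact (hT i).2 ⟨j, hi⟩) ω P).trans hP
  -- The certificate of the stage `j + 1`, which contains the item, is appended to the item's own
  -- conditions.
  refine le_openSup (i := (i.1, i.2.1, i.2.2 ++ γ)) ⟨j + 1, j, by simp, i, by simp [hj], rfl, rfl,
    fun b hb => List.mem_append_left _ hb, hγ.mono (List.subset_append_right _ _)⟩ hω ?_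
  intro b hb
  rcases List.mem_append.1 hb with hb | hb
  exacts [hPi b hb, hPγ b hb]

/-! ### Recursive enumerability of certificates and trimming -/

open Primrec in
theorem re_stronglyInside :
    REPred fun x : List CondCode × List CondCode => StronglyInside x.1 x.2 := by
  refine REPred.forall_mem snd (REPred.exists_mem
    (p := fun (x : (List CondCode × List CondCode) × CondCode) (b' : CondCode) =>
      b'.1 = x.2.1 ∧ x.2.2.1.val < b'.2.1.val ∧ b'.2.2.val < x.2.2.2.val) (fst.comp fst) ?_)
  have hb : Primrec fun x : ((List CondCode × List CondCode) × CondCode) × CondCode => x.1.2 :=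
    snd.comp fst
  refine PrimrecPred.re (PrimrecPred.and ?_ (PrimrecPred.and ?_ ?_))
  · exact Primrec.eq.comp (fst.comp snd) (fst.comp hb)
  · exact primrecRel_val_lt.comp (fst.comp (snd.comp hb)) (fst.comp (snd.comp snd))
  · exact primrecRel_val_lt.comp (snd.comp (snd.comp snd)) (snd.comp (snd.comp hb))

open Primrec in
theorem re_refutes : REPred fun x : List CondCode × List CondCode => Refutes x.1 x.2 := by
  refine REPred.exists_mem (p := fun (x : List CondCode × List CondCode) (b : CondCode) =>
    ∃ c ∈ x.1, c.1 = b.1 ∧ (c.2.2 = b.2.1 ∨ c.2.1 = b.2.2)) snd (REPred.exists_mem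
    (p := fun (x : (List CondCode × List CondCode) × CondCode) (c : CondCode) =>
      c.1 = x.2.1 ∧ (c.2.2 = x.2.2.1 ∨ c.2.1 = x.2.2.2)) (fst.comp fst) ?_)
  have hb : Primrec fun x : ((List CondCode × List CondCode) × CondCode) × CondCode => x.1.2 :=
    snd.comp fst
  refine PrimrecPred.re (PrimrecPred.and ?_ (PrimrecPred.or ?_ ?_))
  · exact Primrec.eq.comp (fst.comp snd) (fst.comp hb)
  · exact Primrec.eq.comp (snd.comp (snd.comp snd)) (fst.comp (snd.comp hb))
  · exact Primrec.eq.comp (fst.comp (snd.comp snd)) (snd.comp (snd.comp hb))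

open Primrec in
theorem re_covers :
    REPred fun x : StepList × ℕ × List Bool => StepList.Covers x.1 x.2.1 x.2.2 := by
  refine REPred.ex (p := fun (x : StepList × ℕ × List Bool) m =>
    ∀ v ∈ wordsOfLength m, ∃ d ∈ x.1, x.2.1 ≤ d.2.1 ∧ d.1 <+: x.2.2 ++ v) (REPred.forall_mem
      (p := fun (x : (StepList × ℕ × List Bool) × ℕ) (v : List Bool) =>
        ∃ d ∈ x.1.1, x.1.2.1 ≤ d.2.1 ∧ d.1 <+: x.1.2.2 ++ v)
      (primrec_wordsOfLength.comp snd) (REPred.exists_mem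
      (p := fun (x : ((StepList × ℕ × List Bool) × ℕ) × List Bool) (d : List Bool × ℕ × ℕ) =>
        x.1.1.2.1 ≤ d.2.1 ∧ d.1 <+: x.1.1.2.2 ++ x.2) (fst.comp (fst.comp fst)) ?_))
  have h1 : Primrec fun x : (((StepList × ℕ × List Bool) × ℕ) × List Bool) ×
      (List Bool × ℕ × ℕ) => x.1.1.1.2 := snd.comp (fst.comp (fst.comp fst))
  refine REPred.and (PrimrecPred.re ?_) (re_prefix.comp (f := fun x : (((StepList × ℕ × List Bool)
    × ℕ) × List Bool) × (List Bool × ℕ × ℕ) => (x.2.1, x.1.1.1.2.2 ++ x.1.2)) ?_)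
  · exact nat_le.comp (fst.comp h1) (fst.comp (snd.comp snd))
  · exact ((fst.comp snd).pair (list_append.comp (snd.comp h1) (snd.comp fst))).to_comp

open Primrec in
theorem primrec_stepList_sum :
    Primrec fun D : StepList => (D.map fun d => d.2.1 * d.2.2).sum := by
  have : Primrec fun D : StepList =>
      (D.map fun d => d.2.1 * d.2.2).foldr (fun b s => b + s) 0 :=
    list_foldr (f := fun D : StepList => D.map fun d => d.2.1 * d.2.2) (g := fun _ => 0)
      (h := fun _ (y : ℕ × ℕ) => y.1 + y.2)
      (list_map Primrec.id (nat_mul.comp (fst.comp (snd.comp snd)) (snd.comp (snd.comp snd))))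
      (Primrec.const 0) (nat_add.comp (fst.comp snd) (snd.comp snd))
  exact this

open Primrec in
theorem re_stepList_bounds : REPred fun x : List CondCode × StepList × ℕ =>
    ∀ d ∈ x.2.1, ∃ c ∈ x.1, c.1 = d.1 ∧ c.2.2 = (d.2.2, 0, x.2.2) := by
  refine REPred.forall_mem
    (p := fun (x : List CondCode × StepList × ℕ) (d : List Bool × ℕ × ℕ) =>
      ∃ c ∈ x.1, c.1 = d.1 ∧ c.2.2 = (d.2.2, 0, x.2.2)) (fst.comp snd) (REPred.exists_mem
    (p := fun (x : (List CondCode × StepList × ℕ) × (List Bool × ℕ × ℕ))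
      (c : CondCode) => c.1 = x.2.1 ∧ c.2.2 = (x.2.2.2, 0, x.1.2.2))
    (fst.comp fst) (PrimrecPred.re (PrimrecPred.and ?_ ?_)))
  · exact Primrec.eq.comp (fst.comp snd) (fst.comp (snd.comp fst))
  · exact Primrec.eq.comp (snd.comp (snd.comp snd)) ((snd.comp (snd.comp (snd.comp fst))).pair
      ((Primrec.const 0).pair (snd.comp (snd.comp (fst.comp fst)))))

open Primrec in
theorem re_refutes_or_covers : REPred fun x : (List CondCode × StepList) × Item =>
    Refutes x.1.1 x.2.2.2 ∨ StepList.Covers x.1.2 x.2.1 x.2.2.1 := by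
  refine REPred.or ?_ ?_
  · exact re_refutes.comp (f := fun x : (List CondCode × StepList) × Item => (x.1.1, x.2.2.2))
      ((fst.comp fst).pair (snd.comp (snd.comp snd))).to_comp
  · exact re_covers.comp
      (f := fun x : (List CondCode × StepList) × Item => (x.1.2, x.2.1, x.2.2.1))
      ((snd.comp fst).pair ((fst.comp snd).pair (fst.comp (snd.comp snd)))).to_comp

open Primrec in
theorem re_stage_refutes_or_covers : REPred fun x : (ℕ × ℕ) × List CondCode × StepList =>
    ∀ j ∈ List.range x.1.2, ∀ i ∈ (universalEnum Item x.1.1 j).toList,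
      Refutes x.2.1 i.2.2 ∨ StepList.Covers x.2.2 i.1 i.2.1 := by
  refine REPred.forall_mem (p := fun (x : (ℕ × ℕ) × List CondCode × StepList) (j : ℕ) =>
    ∀ i ∈ (universalEnum Item x.1.1 j).toList,
      Refutes x.2.1 i.2.2 ∨ StepList.Covers x.2.2 i.1 i.2.1)
    (list_range.comp (snd.comp fst)) (REPred.forall_mem
    (p := fun (x : ((ℕ × ℕ) × List CondCode × StepList) × ℕ) (i : Item) =>
      Refutes x.1.2.1 i.2.2 ∨ StepList.Covers x.1.2.2 i.1 i.2.1)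
    (optionToList.comp (primrec_universalEnum.comp (fst.comp (fst.comp fst)) snd)) ?_)
  exact re_refutes_or_covers.comp
    (f := fun x : (((ℕ × ℕ) × List CondCode × StepList) × ℕ) × Item => (x.1.1.2, x.2))
    ((snd.comp (fst.comp fst)).pair snd).to_comp

open Primrec in
theorem re_certifies : REPred fun x : (ℕ × ℕ) × List CondCode =>
    Certifies (universalEnum Item x.1.1) x.1.2 x.2 := by
  refine REPred.ex (REPred.ex (p := fun (x : ((ℕ × ℕ) × List CondCode) × StepList) (N : ℕ) =>
    (∀ d ∈ x.2, ∃ c ∈ x.1.2, c.1 = d.1 ∧ c.2.2 = (d.2.2, 0, N)) ∧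
    (x.2.map fun d => d.2.1 * d.2.2).sum ≤ 3 * (N + 1) ∧
    ∀ j ∈ List.range x.1.1.2, ∀ i ∈ (universalEnum Item x.1.1.1 j).toList,
      Refutes x.1.2 i.2.2 ∨ StepList.Covers x.2 i.1 i.2.1) ?_)
  refine REPred.and ?_ (REPred.and (PrimrecPred.re ?_) ?_)
  · exact re_stepList_bounds.comp
      (f := fun x : (((ℕ × ℕ) × List CondCode) × StepList) × ℕ => (x.1.1.2, x.1.2, x.2))
      ((snd.comp (fst.comp fst)).pair ((snd.comp fst).pair snd)).to_comp
  · exact nat_le.comp (primrec_stepList_sum.comp (snd.comp fst))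
      (nat_mul.comp (Primrec.const 3) (succ.comp snd))
  · exact re_stage_refutes_or_covers.comp
      (f := fun x : (((ℕ × ℕ) × List CondCode) × StepList) × ℕ => (x.1.1.1, x.1.1.2, x.1.2))
      ((fst.comp (fst.comp fst)).pair ((snd.comp (fst.comp fst)).pair (snd.comp fst))).to_comp

open Primrec in
theorem re_trimmed : REPred fun x : ℕ × Item => Trimmed (universalEnum Item x.1) x.2 := by
  refine REPred.ex (REPred.exists_mem (p := fun (x : (ℕ × Item) × ℕ) (j : ℕ) =>
    ∃ i' ∈ (universalEnum Item x.1.1 j).toList, x.1.2.1 = i'.1 ∧ x.1.2.2.1 = i'.2.1 ∧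
      (∀ b ∈ i'.2.2, b ∈ x.1.2.2.2) ∧ Certifies (universalEnum Item x.1.1) x.2 x.1.2.2.2)
    (list_range.comp snd) (REPred.exists_mem
    (p := fun (x : ((ℕ × Item) × ℕ) × ℕ) (i' : Item) =>
      x.1.1.2.1 = i'.1 ∧ x.1.1.2.2.1 = i'.2.1 ∧ (∀ b ∈ i'.2.2, b ∈ x.1.1.2.2.2) ∧
        Certifies (universalEnum Item x.1.1.1) x.1.2 x.1.1.2.2.2)
    (optionToList.comp (primrec_universalEnum.comp (fst.comp (fst.comp fst)) snd)) ?_))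
  have hx : Primrec fun y : (((ℕ × Item) × ℕ) × ℕ) × Item => y.1.1.1.2 :=
    snd.comp (fst.comp (fst.comp fst))
  have hγ : Primrec fun y : (((ℕ × Item) × ℕ) × ℕ) × Item => y.1.1.1.2.2.2 :=
    snd.comp (snd.comp hx)
  refine REPred.and (PrimrecPred.re (Primrec.eq.comp (fst.comp hx) (fst.comp snd)))
    (REPred.and (PrimrecPred.re (Primrec.eq.comp (fst.comp (snd.comp hx)) (fst.comp (snd.comp snd))))
    (REPred.and (REPred.forall_mem (p := fun (y : (((ℕ × Item) × ℕ) × ℕ) × Item) b =>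
      b ∈ y.1.1.1.2.2.2) (snd.comp (snd.comp snd)) ?_) ?_))
  · exact PrimrecPred.re (primrecRel_mem_list.comp snd (hγ.comp fst))
  · exact re_certifies.comp (f := fun y : (((ℕ × Item) × ℕ) × ℕ) × Item =>
      ((y.1.1.1.1, y.1.1.2), y.1.1.1.2.2.2))
      (((fst.comp (fst.comp (fst.comp fst))).pair (snd.comp (fst.comp fst))).pair hγ).to_comp

/-! ### The universal uniform test -/

theorem coe_val_lt_natCast_div (r : RatCode) (k e : ℕ) :
    (((r.val : ℚ) : ℝ) : EReal) < (((k : ℝ≥0∞) / 2 ^ e : ℝ≥0∞) : EReal) ↔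
      r.val < RatCode.val (k, 0, 2 ^ e - 1) := by
  have h1 : ((k : ℝ≥0∞) / 2 ^ e) = (((k : ℝ≥0) / 2 ^ e : ℝ≥0) : ℝ≥0∞) := by
    rw [ENNReal.coe_div (by positivity)]
    simp
  have h2 : ((RatCode.val (k, 0, 2 ^ e - 1) : ℚ) : ℝ) = k / 2 ^ e := by
    simp [RatCode.val]
  rw [h1, ← Rat.cast_lt (K := ℝ), h2]
  change (((r.val : ℚ) : ℝ) : EReal) < ((((k : ℝ≥0) / 2 ^ e : ℝ≥0) : ℝ) : EReal) ↔ _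
  rw [EReal.coe_lt_coe_iff]
  simp

theorem primrec_two_pow : Primrec fun n : ℕ => 2 ^ n := by
  refine (Primrec.nat_rec₁ (f := fun _ m => 2 * m) 1
    (Primrec.nat_mul.comp (Primrec.const 2) Primrec.snd)).of_eq fun n => ?_
  induction n with
  | zero => rfl
  | succ n ih => rw [pow_succ']; simp only [← ih]

/-- The weighted supremum of all trimmed functions. -/
noncomputable def universalTest (ω : Cantor) (P : Meas) : ℝ≥0∞ :=
  ⨆ e : ℕ, openSup (Trimmed (universalEnum Item e)) ω P / 2 ^ (e + 3)

theorem lintegral_universalTest_le (P : Meas) :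
    ∫⁻ ω, universalTest ω P ∂(P : Measure Cantor) ≤ 1 := by
  calc ∫⁻ ω, universalTest ω P ∂(P : Measure Cantor)
      ≤ ∫⁻ ω, ∑' e : ℕ, openSup (Trimmed (universalEnum Item e)) ω P / 2 ^ (e + 3)
          ∂(P : Measure Cantor) :=
        lintegral_mono fun ω => iSup_le fun e => ENNReal.le_tsum e
    _ = ∑' e : ℕ, ∫⁻ ω, openSup (Trimmed (universalEnum Item e)) ω P / 2 ^ (e + 3)
          ∂(P : Measure Cantor) :=
        lintegral_tsum fun e => ((measurable_openSup _ P).div_const _).aemeasurable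
    -- The bound 3 is relaxed to 4, and `4 / 2 ^ (e + 3) = 2⁻¹ ^ (e + 1)`; these weights sum to 1.
    _ ≤ ∑' e : ℕ, 2⁻¹ ^ (e + 1) := by
        refine ENNReal.tsum_le_tsum fun e => ?_
        simp only [div_eq_mul_inv]
        rw [lintegral_mul_const _ (measurable_openSup _ P)]
        calc _ ≤ 4 * ((2 : ℝ≥0∞) ^ (e + 3))⁻¹ := by
              gcongr
              exact (lintegral_trimmed_le _ P).trans (by norm_num)
          _ = 2⁻¹ ^ (e + 1) := by
              rw [← ENNReal.inv_pow, show e + 3 = (e + 1) + 2 by rfl,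
                pow_add, ENNReal.mul_inv (by simp) (by simp), mul_comm, mul_assoc]
              rw [show (2 : ℝ≥0∞) ^ 2 = 4 by norm_num,
                ENNReal.inv_mul_cancel (by simp) (by simp), mul_one]
    _ = 1 := by
        rw [ENNReal.tsum_geometric_add_one, ENNReal.one_sub_inv_two, inv_inv,
          ENNReal.inv_mul_cancel (by simp) (by simp)]

theorem lowerSemicomputable_universalTest : LowerSemicomputable₂ universalTest := by
  -- For negative `r` the whole space must be enumerated, even where no item is active.
  let W₁ : RatCode × List Bool × List CondCode → Prop := fun x =>
    x.1.val < RatCode.val (0, 0, 0) ∧ x.2 = ([], [])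
  let W₂ : RatCode × List Bool × List CondCode → Prop := fun x => ∃ e k : ℕ,
    Trimmed (universalEnum Item e) (k, x.2) ∧ x.1.val < RatCode.val (k, 0, 2 ^ (e + 3) - 1)
  refine ⟨fun x => W₁ x ∨ W₂ x, REPred.or (PrimrecPred.re (PrimrecPred.and ?_ ?_))
    (REPred.ex (REPred.ex (p := fun (x : (RatCode × List Bool × List CondCode) × ℕ) (k : ℕ) =>
      Trimmed (universalEnum Item x.2) (k, x.1.2) ∧
        x.1.1.val < RatCode.val (k, 0, 2 ^ (x.2 + 3) - 1)) (REPred.and ?_ ?_))), ?_⟩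
  · exact primrecRel_val_lt.comp Primrec.fst (Primrec.const _)
  · exact Primrec.eq.comp Primrec.snd (Primrec.const _)
  · exact re_trimmed.comp (f := fun x : ((RatCode × List Bool × List CondCode) × ℕ) × ℕ =>
      (x.1.2, x.2, x.1.1.2)) ((Primrec.snd.comp Primrec.fst).pair (Primrec.snd.pair
        (Primrec.snd.comp (Primrec.fst.comp Primrec.fst)))).to_comp
  · exact PrimrecPred.re <| primrecRel_val_lt.comp (Primrec.fst.comp (Primrec.fst.comp Primrec.fst))
      (Primrec.snd.pair ((Primrec.const 0).pair (Primrec.nat_sub.comp (primrec_two_pow.comp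
        (Primrec.nat_add.comp (Primrec.snd.comp Primrec.fst) (Primrec.const 3)))
          (Primrec.const 1))))
  · intro r
    ext ⟨ω, P⟩
    simp only [Set.mem_ofPred_eq, Set.mem_iUnion, Set.mem_prod, exists_prop]
    constructor
    · intro h
      by_cases hr : r.val < RatCode.val (0, 0, 0)
      · exact ⟨([], []), .inl ⟨hr, rfl⟩, by simp⟩
      · have h0 : (0 : EReal) ≤ (((r.val : ℚ) : ℝ) : EReal) := by
          have : (0 : ℚ) ≤ r.val := by simpa [RatCode.val] using hr
          exact_mod_cast this
        obtain ⟨a, ha⟩ : ∃ a : ℝ≥0∞, (a : EReal) = (((r.val : ℚ) : ℝ) : EReal) :=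
          ⟨_, EReal.coe_toENNReal h0⟩
        rw [← ha, EReal.coe_ennreal_lt_coe_ennreal_iff, universalTest, lt_iSup_iff] at h
        obtain ⟨e, h⟩ := h
        rw [ENNReal.lt_div_iff_mul_lt (by simp) (by simp), lt_openSup_iff] at h
        obtain ⟨i, hi, hω, hP, h⟩ := h
        rw [← ENNReal.lt_div_iff_mul_lt (by simp) (by simp),
          ← EReal.coe_ennreal_lt_coe_ennreal_iff, ha, coe_val_lt_natCast_div] at h
        exact ⟨i.2, .inr ⟨e, i.1, hi, h⟩, hω, hP⟩
    · rintro ⟨b, ⟨hr, -⟩ | ⟨e, k, hi, hr⟩, hω, hP⟩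
      · refine lt_of_lt_of_le ?_ (EReal.coe_ennreal_nonneg _)
        have : r.val < (0 : ℚ) := by simpa [RatCode.val] using hr
        exact_mod_cast this
      · refine lt_of_lt_of_le ((coe_val_lt_natCast_div r k (e + 3)).2 hr)
          (EReal.coe_ennreal_le_coe_ennreal_iff.2 ?_)
        refine le_trans ?_ (le_iSup _ e)
        gcongr
        exact le_openSup (i := (k, b)) hi hω hP

theorem isUniformTest_universalTest : IsUniformTest universalTest :=
  ⟨lowerSemicomputable_universalTest, lintegral_universalTest_le⟩

/-- Every lower semicomputable function is bounded by the supremum of a recursively enumerable set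
of items, even the closed version of which exceeds the function by at most one. -/
theorem LowerSemicomputable₂.exists_items {f : Cantor → Meas → ℝ≥0∞}
    (hf : LowerSemicomputable₂ f) : ∃ T : Item → Prop, REPred T ∧
      (∀ ω P, f ω P ≤ openSup T ω P) ∧ ∀ ω P, closedSup T ω P ≤ f ω P + 1 := by
  obtain ⟨W, hW, h⟩ := hf
  have hval (k : ℕ) : (((RatCode.val (k, 0, 0) : ℚ) : ℝ) : EReal) = ((k : ℝ≥0∞) : EReal) := by
    have : ((RatCode.val (k, 0, 0) : ℚ) : ℝ) = k := by simp [RatCode.val]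
    rw [this]
    rfl
  have hmem (k : ℕ) (ω : Cantor) (P : Meas) : (k : ℝ≥0∞) < f ω P ↔
      ∃ x β, W ((k, 0, 0), x, β) ∧ ω ∈ cyl x ∧ P ∈ basicSet β := by
    have := Set.ext_iff.1 (h (k, 0, 0)) (ω, P)
    simp only [Set.mem_ofPred_eq, hval, EReal.coe_ennreal_lt_coe_ennreal_iff, Set.mem_iUnion,
      Set.mem_prod, exists_prop, Prod.exists] at this
    exact this
  -- An item of height `k + 1` is placed where `k < f`: rounding up puts `openSup` above `f`, while
  -- `closedSup` exceeds `f` by at most 1.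
  refine ⟨fun i => ∃ (k : ℕ) (β : List CondCode), i.1 = k + 1 ∧ W ((k, 0, 0), i.2.1, β) ∧
    StronglyInside i.2.2 β, ?_, fun ω P => ?_, fun ω P => closedSup_le ?_⟩
  · refine REPred.ex (REPred.ex (p := fun (x : Item × ℕ) (β : List CondCode) =>
      x.1.1 = x.2 + 1 ∧ W ((x.2, 0, 0), x.1.2.1, β) ∧ StronglyInside x.1.2.2 β)
      (REPred.and (PrimrecPred.re ?_) (REPred.and ?_ ?_)))
    · exact Primrec.eq.comp (Primrec.fst.comp (Primrec.fst.comp Primrec.fst))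
        (Primrec.succ.comp (Primrec.snd.comp Primrec.fst))
    · exact hW.comp (f := fun x : (Item × ℕ) × List CondCode =>
        ((x.1.2, 0, 0), x.1.1.2.1, x.2)) (((Primrec.snd.comp Primrec.fst).pair
          (Primrec.const (0, 0))).pair ((Primrec.fst.comp (Primrec.snd.comp
            (Primrec.fst.comp Primrec.fst))).pair Primrec.snd)).to_comp
    · exact re_stronglyInside.comp (f := fun x : (Item × ℕ) × List CondCode => (x.1.1.2.2, x.2))
        ((Primrec.snd.comp (Primrec.snd.comp (Primrec.fst.comp Primrec.fst))).pair
          Primrec.snd).to_comp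
  · refine le_of_forall_lt fun a ha => ?_
    have hex : ∃ k : ℕ, a < k + 1 ∧ (k : ℝ≥0∞) < f ω P := by
      lift a to ℝ≥0 using ha.ne_top
      by_cases ha0 : (⌊a⌋₊ : ℝ≥0∞) < f ω P
      · exact ⟨⌊a⌋₊, by exact_mod_cast Nat.lt_floor_add_one a, ha0⟩
      · exact absurd (lt_of_le_of_lt (by exact_mod_cast Nat.floor_le (zero_le (a := a))) ha) ha0
    obtain ⟨k, hk, hf⟩ := hex
    obtain ⟨x, β, hw, hω, hP⟩ := (hmem k ω P).1 hf
    obtain ⟨β', hβ, hP'⟩ := exists_stronglyInside hP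
    exact lt_openSup_iff.2 ⟨(k + 1, x, β'), ⟨k, β, rfl, hw, hβ⟩, hω, hP', by exact_mod_cast hk⟩
  · rintro ⟨k', x, β'⟩ ⟨k, β, hk, hw, hβ⟩ hω hP
    simp only at hk
    subst hk
    have := (hmem k ω P).2 ⟨x, β, hw, hω, hβ.closedSet_subset hP⟩
    push_cast
    gcongr

/-- The constant depends only on the index of an enumeration for `f`, and the integral hypothesis is
used one `P` at a time. So `f` need not be a uniform test, which is what class tests require. -/
theorem exists_le_mul_universalTest {f : Cantor → Meas → ℝ≥0∞} (hf : LowerSemicomputable₂ f) :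
    ∃ c : ℝ≥0, ∀ P : Meas, ∫⁻ ω, f ω P ∂(P : Measure Cantor) ≤ 1 →
      ∀ ω, f ω P ≤ c * universalTest ω P := by
  obtain ⟨T, hT, hT1, hT2⟩ := hf.exists_items
  obtain ⟨e, he⟩ := hT.exists_universalEnum
  refine ⟨2 ^ (e + 3), fun P hP ω => (hT1 ω P).trans ?_⟩
  have hint : ∫⁻ ω, closedSup T ω P ∂(P : Measure Cantor) ≤ 2 := by
    refine (lintegral_mono fun ω => hT2 ω P).trans ?_
    rw [lintegral_add_right _ measurable_const, lintegral_const, measure_univ, mul_one,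
      ← one_add_one_eq_two]
    gcongr
  refine (openSup_le_trimmed he hint ω).trans ?_
  have := le_iSup (fun e : ℕ => openSup (Trimmed (universalEnum Item e)) ω P / 2 ^ (e + 3)) e
  rw [ENNReal.div_le_iff_le_mul (by simp) (by simp)] at this
  rw [mul_comm]
  push_cast
  exact this

theorem isUniversalUniformTest_universalTest : IsUniversalUniformTest universalTest := by
  refine ⟨isUniformTest_universalTest, fun s hs => ?_⟩
  obtain ⟨c, hc⟩ := exists_le_mul_universalTest hs.1
  exact ⟨c, fun ω P => hc P (hs.2 P) ω⟩

/-! ### Effectively compact classes -/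

theorem LowerSemicomputable.const_right {s : Cantor → ℝ≥0∞} (hs : LowerSemicomputable s) :
    LowerSemicomputable₂ fun ω _ => s ω := by
  obtain ⟨W, hW, h⟩ := hs
  refine ⟨fun x => W (x.1, x.2.1) ∧ x.2.2 = [], REPred.and ?_ (PrimrecPred.re ?_), fun r => ?_⟩
  · exact hW.comp (f := fun x : RatCode × List Bool × List CondCode => (x.1, x.2.1))
      (Primrec.fst.pair (Primrec.fst.comp Primrec.snd)).to_comp
  · exact Primrec.eq.comp (Primrec.snd.comp Primrec.snd) (Primrec.const [])
  · ext ⟨ω, P⟩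
    have := Set.ext_iff.1 (h r) ω
    simp only [Set.mem_ofPred_eq, Set.mem_iUnion, exists_prop] at this
    simp only [Set.mem_ofPred_eq, this, Set.mem_iUnion, Set.mem_prod, exists_prop]
    constructor
    · rintro ⟨x, hx, hω⟩
      exact ⟨(x, []), ⟨hx, rfl⟩, hω, by simp⟩
    · rintro ⟨b, ⟨hb, -⟩, hω, -⟩
      exact ⟨b.1, hb, hω⟩

/-- A strict bound on an infimum needs a gap, supplied by an intermediate rational `r'`. -/
theorem lt_iInf_class_iff {C : Set Meas} {g : Meas → ℝ≥0∞} {r : RatCode} :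
    (((r.val : ℚ) : ℝ) : EReal) < ((⨅ P ∈ C, g P : ℝ≥0∞) : EReal) ↔
      ∃ r' : RatCode, r.val < r'.val ∧ ∀ P ∈ C, (((r'.val : ℚ) : ℝ) : EReal) < (g P : EReal) := by
  constructor
  · intro h
    obtain ⟨q, h1, h2⟩ := EReal.exists_rat_btwn_of_lt h
    obtain ⟨r', rfl⟩ := RatCode.val_surjective q
    exact ⟨r', by exact_mod_cast h1, fun P hP => lt_of_lt_of_le h2
      (EReal.coe_ennreal_le_coe_ennreal_iff.2 (iInf₂_le P hP))⟩
  · rintro ⟨r', h1, h2⟩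
    refine lt_of_lt_of_le (b := (((r'.val : ℚ) : ℝ) : EReal)) (by exact_mod_cast h1) ?_
    rcases le_total (0 : EReal) (((r'.val : ℚ) : ℝ) : EReal) with h0 | h0
    · rw [← EReal.coe_toENNReal h0]
      refine EReal.coe_ennreal_le_coe_ennreal_iff.2 (le_iInf₂ fun P hP => ?_)
      rw [← EReal.coe_ennreal_le_coe_ennreal_iff, EReal.coe_toENNReal h0]
      exact (h2 P hP).le
    · exact h0.trans (EReal.coe_ennreal_nonneg _)

/-- For fixed `ω`, the basic sets enumerated for `r'` whose words are prefixes of `ω` cover `C`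
exactly when `r' < t ω P` on `C`. By compactness finitely many suffice, and effective compactness
makes finite covers recognizable. -/
theorem LowerSemicomputable₂.iInf {C : Set Meas} (hC : EffectivelyCompact C)
    {t : Cantor → Meas → ℝ≥0∞} (ht : LowerSemicomputable₂ t) :
    LowerSemicomputable fun ω => ⨅ P ∈ C, t ω P := by
  obtain ⟨W, hW, h⟩ := ht
  have hmem (r : RatCode) (ω : Cantor) (P : Meas) :
      (((r.val : ℚ) : ℝ) : EReal) < (t ω P : EReal) ↔
        ∃ b, W (r, b) ∧ ω ∈ cyl b.1 ∧ P ∈ basicSet b.2 := by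
    have := Set.ext_iff.1 (h r) (ω, P)
    simpa only [Set.mem_ofPred_eq, Set.mem_iUnion, Set.mem_prod, exists_prop] using this
  let Cov : List (List CondCode) → Prop := fun S => C ⊆ ⋃ β ∈ {β | β ∈ S}, basicSet β
  have hsnd : Primrec₂ fun (_ : List (List Bool × List CondCode))
      (b : List Bool × List CondCode) => b.2 := Primrec.snd.comp Primrec.snd
  have hmap : Primrec fun S : List (List Bool × List CondCode) => S.map Prod.snd :=
    Primrec.list_map Primrec.id hsnd
  have hCov : REPred fun S : List (List Bool × List CondCode) => Cov (S.map Prod.snd) :=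
    REPred.comp (p := Cov) hC.2 hmap.to_comp
  refine ⟨fun y => ∃ (r' : RatCode) (S : List (List Bool × List CondCode)),
    y.1.val < r'.val ∧ (∀ b ∈ S, W (r', b) ∧ b.1 <+: y.2) ∧ Cov (S.map Prod.snd), ?_, fun r => ?_⟩
  · refine REPred.ex (REPred.ex (p := fun (y : (RatCode × List Bool) × RatCode)
      (S : List (List Bool × List CondCode)) => y.1.1.val < y.2.val ∧
        (∀ b ∈ S, W (y.2, b) ∧ b.1 <+: y.1.2) ∧ Cov (S.map Prod.snd))
      (REPred.and (PrimrecPred.re ?_) (REPred.and (REPred.forall_mem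
        (p := fun (y : ((RatCode × List Bool) × RatCode) × List (List Bool × List CondCode))
          (b : List Bool × List CondCode) => W (y.1.2, b) ∧ b.1 <+: y.1.1.2) Primrec.snd
          (REPred.and ?_ ?_)) ?_)))
    · exact primrecRel_val_lt.comp (Primrec.fst.comp (Primrec.fst.comp Primrec.fst))
        (Primrec.snd.comp Primrec.fst)
    · exact hW.comp (f := fun y : (((RatCode × List Bool) × RatCode) ×
        List (List Bool × List CondCode)) × List Bool × List CondCode => (y.1.1.2, y.2))
        ((Primrec.snd.comp (Primrec.fst.comp Primrec.fst)).pair Primrec.snd).to_comp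
    · exact re_prefix.comp (f := fun y : (((RatCode × List Bool) × RatCode) ×
        List (List Bool × List CondCode)) × List Bool × List CondCode => (y.2.1, y.1.1.1.2))
        ((Primrec.fst.comp Primrec.snd).pair (Primrec.snd.comp
          (Primrec.fst.comp (Primrec.fst.comp Primrec.fst)))).to_comp
    · exact hCov.comp Primrec.snd.to_comp
  · ext ω
    simp only [Set.mem_ofPred_eq, Set.mem_iUnion, exists_prop, lt_iInf_class_iff]
    constructor
    · rintro ⟨r', hr, hω⟩
      choose! b hbW hbω hbP using fun P hP => (hmem r' ω P).1 (hω P hP)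
      obtain ⟨F, hFC, hF⟩ := hC.1.elim_nhds_subcover (fun P => basicSet (b P).2)
        fun P hP => (isOpen_basicSet _).mem_nhds (hbP P hP)
      set S : List (List Bool × List CondCode) := F.toList.map b
      have hS : ∀ c ∈ S, W (r', c) ∧ ω ∈ cyl c.1 := by
        intro c hc
        obtain ⟨P, hP, rfl⟩ := List.mem_map.1 hc
        have hP := hFC P (Finset.mem_toList.1 hP)
        exact ⟨hbW P hP, hbω P hP⟩
      have hlen : ∀ c ∈ S, c.1.length ≤ (S.map fun c => c.1.length).sum :=
        fun c hc => List.le_sum_of_mem (List.mem_map_of_mem (f := fun c => c.1.length) hc)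
      -- The sum of the word lengths bounds each of them, so this prefix of `ω` extends every word
      -- in `S`.
      refine ⟨initSeg ω (S.map fun c => c.1.length).sum, ⟨r', S, hr, fun c hc =>
        ⟨(hS c hc).1, prefix_initSeg (hlen c hc) (hS c hc).2⟩, fun P hP => ?_⟩,
        mem_cyl_initSeg _ _⟩
      have := hF hP
      simp only [Set.mem_iUnion, exists_prop] at this ⊢
      obtain ⟨Q, hQ, hPQ⟩ := this
      exact ⟨(b Q).2, List.mem_map_of_mem
        (List.mem_map_of_mem (Finset.mem_toList.2 hQ)), hPQ⟩
    · rintro ⟨x, ⟨r', S, hr, hS, hcov⟩, hω⟩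
      refine ⟨r', hr, fun P hP => ?_⟩
      have := hcov hP
      simp only [Set.mem_iUnion, exists_prop] at this
      obtain ⟨β, hβ, hPβ⟩ := this
      obtain ⟨b, hb, rfl⟩ := List.mem_map.1 hβ
      exact (hmem r' ω P).2 ⟨b, (hS b hb).1, cyl_subset_of_prefix (hS b hb).2 hω, hPβ⟩

theorem IsUniversalUniformTest.iInf {C : Set Meas} (hC : EffectivelyCompact C)
    {t : Cantor → Meas → ℝ≥0∞} (ht : IsUniversalUniformTest t) :
    IsUniversalClassTest C fun ω => ⨅ P ∈ C, t ω P := by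
  refine ⟨⟨ht.1.1.iInf hC, fun P hP => (lintegral_mono fun ω => iInf₂_le P hP).trans
    (ht.1.2 P)⟩, fun s hs => ?_⟩
  obtain ⟨c, hc⟩ := exists_le_mul_universalTest hs.1.const_right
  obtain ⟨c', hc'⟩ := ht.2 _ isUniformTest_universalTest
  -- The `+ 1` makes the constant nonzero, so it can be divided out before passing to the infimum.
  refine ⟨c * c' + 1, fun ω => ?_⟩
  have hne : ((c * c' + 1 : ℝ≥0) : ℝ≥0∞) ≠ 0 := by
    exact_mod_cast (show c * c' + 1 ≠ 0 by positivity)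
  rw [← ENNReal.div_le_iff' hne ENNReal.coe_ne_top]
  refine le_iInf₂ fun P hP => ?_
  rw [ENNReal.div_le_iff' hne ENNReal.coe_ne_top]
  calc s ω ≤ c * universalTest ω P := hc P (hs.2 P hP) ω
    _ ≤ c * (c' * t ω P) := by gcongr; exact hc' ω P
    _ = ((c * c' : ℝ≥0) : ℝ≥0∞) * t ω P := by push_cast; ring
    _ ≤ _ := by gcongr; exact le_self_add

end AlgRandom

theorem mainTheorem5 (C : Set AlgRandom.Meas) (hC : AlgRandom.EffectivelyCompact C) :
    (∃ u : AlgRandom.Cantor → ℝ≥0∞, AlgRandom.IsUniversalClassTest C u) ∧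
    (∃ t : AlgRandom.Cantor → AlgRandom.Meas → ℝ≥0∞, AlgRandom.IsUniversalUniformTest t) ∧
    ∀ t : AlgRandom.Cantor → AlgRandom.Meas → ℝ≥0∞, AlgRandom.IsUniversalUniformTest t →
      AlgRandom.IsUniversalClassTest C (fun ω => ⨅ P ∈ C, t ω P) ∧
      ∀ u : AlgRandom.Cantor → ℝ≥0∞, AlgRandom.IsUniversalClassTest C u →
        ∃ c : ℝ≥0, ∀ ω, u ω ≤ (c : ℝ≥0∞) * (⨅ P ∈ C, t ω P) ∧
          (⨅ P ∈ C, t ω P) ≤ (c : ℝ≥0∞) * u ω := by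
  refine ⟨⟨_, AlgRandom.isUniversalUniformTest_universalTest.iInf hC⟩,
    ⟨_, AlgRandom.isUniversalUniformTest_universalTest⟩, fun t ht => ?_⟩
  have hinf := ht.iInf hC
  refine ⟨hinf, fun u hu => ?_⟩
  obtain ⟨c, hc⟩ := hinf.2 u hu.1
  obtain ⟨c', hc'⟩ := hu.2 _ hinf.1
  refine ⟨max c c', fun ω => ⟨(hc ω).trans ?_, (hc' ω).trans ?_⟩⟩
  · gcongr
    exact le_max_left _ _
  · gcongr
    exact le_max_right _ _
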